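/- Let $M$ be a connected (Hausdorff, paracompact, finite-dimensional, smooth, boundaryless) manifold with base point $m_0$, let $G$ be a connected Lie group with identity $e$, and let $\rho:\tilde G\to G$ be its universal covering group (a simply connected Lie group $\tilde G$ with a homomorphism $\rho$ that is a smooth covering map). A spinor structure for a principal $G$-bundle $\pi_P:P\to M$ is a principal $\tilde G$-bundle $\pi_Q:Q\to M$ together with a smooth map $u:Q\to P$ such that $\pi_P\circ u=\pi_Q$ and $u(q\tilde g)=u(q)\rho(\tilde g)$ for all $q\in Q$, $\tilde g\in\tilde G$. Two spinor structures $u:Q\to P$ and $u':Q'\to P$ are equivalent if there is an equivalence of principal $\tilde G$-bundles over $M$ (an equivariant diffeomorphism over $M$) $a:Q\to Q'$ with $u'\circ a=u$. A principal bundle is trivial if it is equivalent to the product bundle. Given a spinor structure $u:Q\to P$ and a base point $p_0\in P$ over $m_0$, put $K=u_*(\pi_1(Q))\subseteq\pi_1(P,p_0)$ and $i:G\to P$, $i(g)=p_0g$. The spinor structure $u':Q'\to P$ corresponds to the homomorphism $\varphi:\pi_1(M,m_0)\to\pi_1(G,e)$, relative to $u$, if $u'_*(\pi_1(Q'))=\{k\star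 i_*\varphi(\pi_{P*}k) : k\in K\}$, where base points of $Q$ and $Q'$ are chosen over $p_0$. A smooth map $\zeta:M\to G$ induces (realises) $\varphi$ if $\zeta_*=\varphi$, where $\pi_1(G,\zeta(m_0))$ is identified with $\pi_1(G,e)$ by left translation, i.e. $\varphi[\alpha]=[\zeta(m_0)^{-1}(\zeta\circ\alpha)]$; $\varphi$ is realisable if some smooth $\zeta$ realises it. Let $P=M\times G$ be the product bundle, with base point $p_0=(m_0,e)$. Then $Q=M\times\tilde G$ with $u(m,\tilde g)=(m,\rho(\tilde g))$ is a spinor structure for $P$. Let $\varphi:\pi_1(M,m_0)\to\pi_1(G,e)$ be a homomorphism and let $u':Q'\to P$ be a spinor structure corresponding to $\varphi$ relative to $u$. Then: 1. $\varphi$ is realisable if and only if $Q'$ is trivial as a principal bundle. 2. If a smooth map $\zeta:M\to G$ realises $\varphi$, then $u_\zeta(m,\tilde g)=(m,\zeta(m)\rho(\tilde g))$ defines a spinor structure $u_\zeta:Q\to P$, and there is a bundle equivalence $a:Q\to Q'$ with $u'\circ a=u_\zeta$; that is, $u_\zeta$ and $u'$ are equivalent spinor structures. -/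

import Mathlib

open scoped Manifold ContDiff

section Bundles

variable {EM : Type*} [NormedAddCommGroup EM] [NormedSpace ℝ EM]
  {HM : Type*} [TopologicalSpace HM] (IM : ModelWithCorners ℝ EM HM)
  {EG : Type*} [NormedAddCommGroup EG] [NormedSpace ℝ EG]
  {HG : Type*} [TopologicalSpace HG] (IG : ModelWithCorners ℝ EG HG)
  {EQ : Type*} [NormedAddCommGroup EQ] [NormedSpace ℝ EQ]
  {HQ : Type*} [TopologicalSpace HQ] (IQ : ModelWithCorners ℝ EQ HQ)
  (M : Type*) [TopologicalSpace M] [ChartedSpace HM M]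
  (G : Type*) [Group G] [TopologicalSpace G] [ChartedSpace HG G]
  (Q : Type*) [TopologicalSpace Q] [ChartedSpace HQ Q]

/-- A smooth principal fibre bundle with structure group `G`, total space `Q` and base `M`.
The smooth right action of `G` on `Q` is `act`.  (If `M` and `G` are Hausdorff, then so is `Q`,
by the local trivialisations.) -/
structure PrincipalBundle where
  /-- the projection -/
  proj : Q → M
  /-- the right action of the structure group on the total space -/
  act : Q → G → Q
  contMDiff_proj : ContMDiff IQ IM ∞ proj
  contMDiff_act : ContMDiff (IQ.prod IG) IQ ∞ (fun x : Q × G => act x.1 x.2)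
  act_one : ∀ q, act q 1 = q
  act_mul : ∀ q g h, act q (g * h) = act (act q g) h
  proj_act : ∀ q g, proj (act q g) = proj q
  transitive : ∀ q q', proj q = proj q' → ∃ g, act q g = q'
  free : ∀ q g, act q g = q → g = 1
  local_triv : ∀ m₀ : M, ∃ (U : Set M) (e : PartialDiffeomorph (IM.prod IG) IQ (M × G) Q ∞),
    IsOpen U ∧ m₀ ∈ U ∧ e.source = U ×ˢ Set.univ ∧ e.target = proj ⁻¹' U ∧
    (∀ m ∈ U, ∀ g, proj (e (m, g)) = m) ∧ ∀ m ∈ U, ∀ g, e (m, g) = act (e (m, 1)) g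

/-- The product principal bundle `M × G → M`, with `(m, g) h = (m, g h)`. -/
def PrincipalBundle.trivial [LieGroup IG ∞ G] :
    PrincipalBundle IM IG (IM.prod IG) M G (M × G) where
  proj := Prod.fst
  act x g := (x.1, x.2 * g)
  contMDiff_proj := contMDiff_fst
  contMDiff_act :=
    (contMDiff_fst.comp contMDiff_fst).prodMk
      ((contMDiff_snd.comp contMDiff_fst).mul contMDiff_snd)
  act_one q := by simp
  act_mul q g h := by simp [mul_assoc]
  proj_act q g := rfl
  transitive := by
    rintro ⟨m, g⟩ ⟨m', g'⟩ (rfl : m = m')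
    exact ⟨g⁻¹ * g', by simp⟩
  free := by
    rintro ⟨m, g⟩ h hh
    simpa using hh
  local_triv m₀ :=
    ⟨Set.univ, (Diffeomorph.refl (IM.prod IG) (M × G) ∞).toPartialDiffeomorph,
      isOpen_univ, Set.mem_univ _, Set.univ_prod_univ.symm, rfl, fun _ _ _ => rfl,
      fun m _ g => by
        show (m, g) = (m, 1 * g)
        rw [one_mul]⟩

end Bundles

section Equivalence

variable {EM : Type*} [NormedAddCommGroup EM] [NormedSpace ℝ EM]
  {HM : Type*} [TopologicalSpace HM] {IM : ModelWithCorners ℝ EM HM}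
  {EG : Type*} [NormedAddCommGroup EG] [NormedSpace ℝ EG]
  {HG : Type*} [TopologicalSpace HG] {IG : ModelWithCorners ℝ EG HG}
  {EQ : Type*} [NormedAddCommGroup EQ] [NormedSpace ℝ EQ]
  {HQ : Type*} [TopologicalSpace HQ] {IQ : ModelWithCorners ℝ EQ HQ}
  {ER : Type*} [NormedAddCommGroup ER] [NormedSpace ℝ ER]
  {HR : Type*} [TopologicalSpace HR] {IR : ModelWithCorners ℝ ER HR}
  {M : Type*} [TopologicalSpace M] [ChartedSpace HM M]
  {G : Type*} [Group G] [TopologicalSpace G] [ChartedSpace HG G]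
  {Q : Type*} [TopologicalSpace Q] [ChartedSpace HQ Q]
  {R : Type*} [TopologicalSpace R] [ChartedSpace HR R]

/-- `a : Q → R` is an equivalence of principal `G`-bundles over `M`. -/
def PrincipalBundle.IsEquivalence (B : PrincipalBundle IM IG IQ M G Q)
    (C : PrincipalBundle IM IG IR M G R) (a : Q ≃ₘ^∞⟮IQ, IR⟯ R) : Prop :=
  (∀ q, C.proj (a q) = B.proj q) ∧ ∀ q g, a (B.act q g) = C.act (a q) g

/-- A principal bundle is trivial if it is equivalent to the product bundle. -/
def PrincipalBundle.IsTrivial [LieGroup IG ∞ G] (B : PrincipalBundle IM IG IQ M G Q) : Prop :=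
  ∃ a : (M × G) ≃ₘ^∞⟮IM.prod IG, IQ⟯ Q, (PrincipalBundle.trivial IM IG M G).IsEquivalence B a

/-- Two spinor structures `u : Q → P` and `v : R → P` are equivalent if there is a bundle
equivalence `a : Q → R` with `v ∘ a = u`. -/
def SpinorEquivalent {P : Type*} (B : PrincipalBundle IM IG IQ M G Q)
    (C : PrincipalBundle IM IG IR M G R) (u : Q → P) (v : R → P) : Prop :=
  ∃ a : Q ≃ₘ^∞⟮IQ, IR⟯ R, B.IsEquivalence C a ∧ ∀ q, v (a q) = u q

end Equivalence

section Spinor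

variable {EM : Type*} [NormedAddCommGroup EM] [NormedSpace ℝ EM]
  {HM : Type*} [TopologicalSpace HM] {IM : ModelWithCorners ℝ EM HM}
  {EG : Type*} [NormedAddCommGroup EG] [NormedSpace ℝ EG]
  {HG : Type*} [TopologicalSpace HG] {IG : ModelWithCorners ℝ EG HG}
  {EG' : Type*} [NormedAddCommGroup EG'] [NormedSpace ℝ EG']
  {HG' : Type*} [TopologicalSpace HG'] {IG' : ModelWithCorners ℝ EG' HG'}
  {EP : Type*} [NormedAddCommGroup EP] [NormedSpace ℝ EP]
  {HP : Type*} [TopologicalSpace HP] {IP : ModelWithCorners ℝ EP HP}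
  {EQ : Type*} [NormedAddCommGroup EQ] [NormedSpace ℝ EQ]
  {HQ : Type*} [TopologicalSpace HQ] {IQ : ModelWithCorners ℝ EQ HQ}
  {ER : Type*} [NormedAddCommGroup ER] [NormedSpace ℝ ER]
  {HR : Type*} [TopologicalSpace HR] {IR : ModelWithCorners ℝ ER HR}
  {M : Type*} [TopologicalSpace M] [ChartedSpace HM M]
  {G : Type*} [Group G] [TopologicalSpace G] [ChartedSpace HG G]
  {G' : Type*} [Group G'] [TopologicalSpace G'] [ChartedSpace HG' G']
  {P : Type*} [TopologicalSpace P] [ChartedSpace HP P]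
  {Q : Type*} [TopologicalSpace Q] [ChartedSpace HQ Q]
  {R : Type*} [TopologicalSpace R] [ChartedSpace HR R]

/-- The homomorphism `ρ : G' → G` exhibits the Lie group `G'` as the universal covering group
of `G`: it is a smooth covering map and `G'` is simply connected. -/
structure IsUniversalCoveringGroup (IG' : ModelWithCorners ℝ EG' HG')
    (IG : ModelWithCorners ℝ EG HG) (ρ : G' →* G) : Prop where
  simplyConnected : SimplyConnectedSpace G'
  isCoveringMap : IsCoveringMap ρ
  isLocalDiffeomorph : IsLocalDiffeomorph IG' IG ∞ ρ

/-- `u : Q → P` is a spinor map, i.e. it makes the principal `G'`-bundle `Q` a spinor structure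
for the principal `G`-bundle `P`: it is a smooth bundle morphism over `M` relative to `ρ`. -/
structure IsSpinorMap (ρ : G' →* G) (BQ : PrincipalBundle IM IG' IQ M G' Q)
    (BP : PrincipalBundle IM IG IP M G P) (u : Q → P) : Prop where
  contMDiff : ContMDiff IQ IP ∞ u
  proj_map : ∀ q, BP.proj (u q) = BQ.proj q
  map_act : ∀ q g, u (BQ.act q g) = BP.act (u q) (ρ g)

/-- The projection of a principal bundle as a continuous map. -/
def PrincipalBundle.projMap (BP : PrincipalBundle IM IG IP M G P) : C(P, M) :=
  ⟨BP.proj, BP.contMDiff_proj.continuous⟩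

theorem PrincipalBundle.projMap_eq (BP : PrincipalBundle IM IG IP M G P) {p₀ : P} {m₀ : M}
    (h : BP.proj p₀ = m₀) : BP.projMap p₀ = m₀ := h

/-- The orbit map `i : G → P`, `i g = p₀ g`. -/
def PrincipalBundle.orbitMap (BP : PrincipalBundle IM IG IP M G P) (p₀ : P) : C(G, P) :=
  ⟨fun g => BP.act p₀ g,
    BP.contMDiff_act.continuous.comp (continuous_const.prodMk continuous_id)⟩

theorem PrincipalBundle.orbitMap_one (BP : PrincipalBundle IM IG IP M G P) (p₀ : P) :
    BP.orbitMap p₀ 1 = p₀ := BP.act_one p₀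

/-- A spinor map as a continuous map. -/
def IsSpinorMap.toMap {ρ : G' →* G} {BQ : PrincipalBundle IM IG' IQ M G' Q}
    {BP : PrincipalBundle IM IG IP M G P} {u : Q → P} (hu : IsSpinorMap ρ BQ BP u) : C(Q, P) :=
  ⟨u, hu.contMDiff.continuous⟩

/-- The subgroup `u_*(π₁(Q, q₀))` of `π₁(P, p₀)`, where `u q₀ = p₀`. -/
noncomputable def IsSpinorMap.imagePi {ρ : G' →* G} {BQ : PrincipalBundle IM IG' IQ M G' Q}
    {BP : PrincipalBundle IM IG IP M G P} {u : Q → P} (hu : IsSpinorMap ρ BQ BP u)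
    {q₀ : Q} {p₀ : P} (h : hu.toMap q₀ = p₀) : Subgroup (FundamentalGroup P p₀) :=
  (FundamentalGroup.mapOfEq hu.toMap h).range

/-- The classification of spinor structures relative to a reference spinor structure `u : Q → P`:
the spinor structure `v : R → P` corresponds to the homomorphism `φ : π₁(M, m₀) → π₁(G, 1)` if
`v_*(π₁(R)) = {k ⋆ i_* (φ (π_* k)) | k ∈ u_*(π₁(Q))}` in `π₁(P, p₀)`, where `π : P → M` is the
projection, `π p₀ = m₀`, and `i g = p₀ g`.  The base points of `Q` and `R` are any points over
`p₀` (their choice is immaterial, as the image of `i_*` is central). -/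
def CorrespondsTo {ρ : G' →* G} {BQ : PrincipalBundle IM IG' IQ M G' Q}
    {BR : PrincipalBundle IM IG' IR M G' R} {BP : PrincipalBundle IM IG IP M G P}
    {u : Q → P} {v : R → P} (hu : IsSpinorMap ρ BQ BP u) (hv : IsSpinorMap ρ BR BP v)
    {p₀ : P} {m₀ : M} (hp : BP.proj p₀ = m₀)
    (φ : FundamentalGroup M m₀ →* FundamentalGroup G 1) : Prop :=
  ∃ (q₀ : Q) (hq : hu.toMap q₀ = p₀) (r₀ : R) (hr : hv.toMap r₀ = p₀),
    ∀ x : FundamentalGroup P p₀, x ∈ hv.imagePi hr ↔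
      ∃ k ∈ hu.imagePi hq,
        x = k * FundamentalGroup.mapOfEq (BP.orbitMap p₀) (BP.orbitMap_one p₀)
          (φ (FundamentalGroup.mapOfEq BP.projMap (BP.projMap_eq hp) k))

/-- The map `m ↦ ζ(m₀)⁻¹ ζ(m)`, as a continuous map. -/
noncomputable def translateToOne [LieGroup IG ∞ G] (ζ : C^∞⟮IM, M; IG, G⟯) (m₀ : M) : C(M, G) :=
  ⟨fun m => (ζ m₀)⁻¹ * ζ m, (contMDiff_const.mul ζ.contMDiff).continuous⟩

theorem translateToOne_self [LieGroup IG ∞ G] (ζ : C^∞⟮IM, M; IG, G⟯) (m₀ : M) :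
    translateToOne ζ m₀ m₀ = 1 := inv_mul_cancel (ζ m₀)

/-- The smooth map `ζ : M → G` induces (realises) `φ : π₁(M, m₀) → π₁(G, 1)`.
Here `π₁(G, ζ(m₀))` is identified with `π₁(G, 1)` by left translation, so this says
`φ [α] = [ζ(m₀)⁻¹ (ζ ∘ α)]`; if `ζ(m₀) = 1` it says `φ [α] = [ζ ∘ α]`. -/
def Realises [LieGroup IG ∞ G] {m₀ : M} (ζ : C^∞⟮IM, M; IG, G⟯)
    (φ : FundamentalGroup M m₀ →* FundamentalGroup G 1) : Prop :=
  FundamentalGroup.mapOfEq (translateToOne ζ m₀) (translateToOne_self ζ m₀) = φ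

end Spinor

/-! Identify `π₁(M × G)` with `π₁(M) × π₁(G)`. Since `G'` is simply connected, the product spinor
structure has image `π₁(M) × 1`, so corresponding to `φ` means exactly that `u'_*(π₁(Q'))` is the
graph of `φ` (`CorrespondsTo.exists_mem_imagePi_iff`). The theorem then becomes covering space
theory, because a spinor map is a covering map (`IsSpinorMap.isCoveringMap`).

If `ζ` realises `φ`, the graph of `ζ(m₀)⁻¹ ζ` induces a map on `π₁` with values in the graph of `φ`,
so it lifts through `u'`. Homotopy lifting removes the normalising factor and gives a section `s` of
`Q'` with `u' (s m) = (m, ζ m)`, smooth because `ρ` is a local diffeomorphism. Then `(m, g) ↦ s(m)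
g` trivialises `Q'` and carries `u'` to `u_ζ`. Conversely, a global section of `Q'` followed by `u'`
is the graph of a map `M → G`. Once the section passes through the base point, that map realises
`φ`, since its graph factors through `u'` on `π₁`. -/

section FundamentalGroupMaps

/-! ### Induced maps on fundamental groups and products -/

variable {X Y Z : Type*} [TopologicalSpace X] [TopologicalSpace Y] [TopologicalSpace Z]

theorem FundamentalGroup.mapOfEq_mk (f : C(X, Y)) {x : X} {y : Y} (h : f x = y) (γ : Path x x) :
    FundamentalGroup.mapOfEq f h (Path.Homotopic.Quotient.mk γ : Path.Homotopic.Quotient x x) =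
      (Path.Homotopic.Quotient.mk ((γ.map f.continuous).cast h.symm h.symm) :
        Path.Homotopic.Quotient y y) :=
  FundamentalGroup.mapOfEq_apply f h _

theorem FundamentalGroup.mapOfEq_comp (g : C(Y, Z)) (f : C(X, Y)) {x : X} {y : Y} {z : Z}
    (hf : f x = y) (hg : g y = z) (hgf : (g.comp f) x = z) (a : FundamentalGroup X x) :
    FundamentalGroup.mapOfEq (g.comp f) hgf a =
      FundamentalGroup.mapOfEq g hg (FundamentalGroup.mapOfEq f hf a) := by
  obtain ⟨γ, rfl⟩ := Path.Homotopic.Quotient.mk_surjective a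
  exact (mapOfEq_mk (g.comp f) hgf γ).trans
    (((congrArg _ (mapOfEq_mk f hf γ)).trans (mapOfEq_mk g hg _)).symm)

theorem FundamentalGroup.mapOfEq_eq_self {f : C(X, X)} (hf : ∀ x, f x = x) {x : X}
    (a : FundamentalGroup X x) : FundamentalGroup.mapOfEq f (hf x) a = a := by
  obtain rfl : f = ContinuousMap.id X := ContinuousMap.ext hf
  obtain ⟨γ, rfl⟩ := Path.Homotopic.Quotient.mk_surjective a
  exact mapOfEq_mk (ContinuousMap.id X) _ γ

theorem FundamentalGroup.mapOfEq_eq_one {f : C(X, Y)} {y : Y} (hf : ∀ x, f x = y) {x : X}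
    (a : FundamentalGroup X x) : FundamentalGroup.mapOfEq f (hf x) a = 1 := by
  obtain rfl : f = ContinuousMap.const X y := ContinuousMap.ext hf
  obtain ⟨γ, rfl⟩ := Path.Homotopic.Quotient.mk_surjective a
  exact mapOfEq_mk (ContinuousMap.const X y) _ γ

/-- The projection `π₁(X × Y) → π₁(X)`. -/
noncomputable def FundamentalGroup.fst (x : X) (y : Y) :
    FundamentalGroup (X × Y) (x, y) →* FundamentalGroup X x :=
  FundamentalGroup.mapOfEq ContinuousMap.fst rfl

/-- The projection `π₁(X × Y) → π₁(Y)`. -/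
noncomputable def FundamentalGroup.snd (x : X) (y : Y) :
    FundamentalGroup (X × Y) (x, y) →* FundamentalGroup Y y :=
  FundamentalGroup.mapOfEq ContinuousMap.snd rfl

theorem FundamentalGroup.fst_mapOfEq {f : C(Z, X × Y)} {z : Z} {x : X} {y : Y} (hf : f z = (x, y))
    {g : C(Z, X)} (hg : g z = x) (h : ∀ z, (f z).1 = g z) (a : FundamentalGroup Z z) :
    FundamentalGroup.fst x y (FundamentalGroup.mapOfEq f hf a) =
      FundamentalGroup.mapOfEq g hg a := by
  obtain rfl : g = ContinuousMap.fst.comp f := ContinuousMap.ext fun z => (h z).symm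
  exact (mapOfEq_comp ContinuousMap.fst f hf rfl hg a).symm

theorem FundamentalGroup.snd_mapOfEq {f : C(Z, X × Y)} {z : Z} {x : X} {y : Y} (hf : f z = (x, y))
    {g : C(Z, Y)} (hg : g z = y) (h : ∀ z, (f z).2 = g z) (a : FundamentalGroup Z z) :
    FundamentalGroup.snd x y (FundamentalGroup.mapOfEq f hf a) =
      FundamentalGroup.mapOfEq g hg a := by
  obtain rfl : g = ContinuousMap.snd.comp f := ContinuousMap.ext fun z => (h z).symm
  exact (mapOfEq_comp ContinuousMap.snd f hf rfl hg a).symm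

theorem FundamentalGroup.prod_ext {x : X} {y : Y} {a b : FundamentalGroup (X × Y) (x, y)}
    (h₁ : FundamentalGroup.fst x y a = FundamentalGroup.fst x y b)
    (h₂ : FundamentalGroup.snd x y a = FundamentalGroup.snd x y b) : a = b := by
  have hl : ∀ c : FundamentalGroup (X × Y) (x, y),
      Path.Homotopic.projLeft c = FundamentalGroup.fst x y c := fun c => by
    obtain ⟨γ, rfl⟩ := Path.Homotopic.Quotient.mk_surjective c
    exact (mapOfEq_mk ContinuousMap.fst rfl γ).symm
  have hr : ∀ c : FundamentalGroup (X × Y) (x, y),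
      Path.Homotopic.projRight c = FundamentalGroup.snd x y c := fun c => by
    obtain ⟨γ, rfl⟩ := Path.Homotopic.Quotient.mk_surjective c
    exact (mapOfEq_mk ContinuousMap.snd rfl γ).symm
  rw [← Path.Homotopic.prod_projLeft_projRight a, ← Path.Homotopic.prod_projLeft_projRight b,
    hl, hl, hr, hr, h₁, h₂]

end FundamentalGroupMaps

/-! ### Spinor maps as coverings; smooth lifts and sections -/

/-- In the chart `e`, `u` is the pullback of `ρ` along `(m, h) ↦ σ(m)⁻¹ h`, and even covering is
stable under pullback. -/
theorem isEvenlyCovered_of_trivialization_mul {M G G' Q : Type*} [TopologicalSpace M]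
    [TopologicalSpace G] [Group G] [IsTopologicalGroup G] [TopologicalSpace G']
    [TopologicalSpace Q] {ρ : G' → G} {u : Q → M × G} (e : OpenPartialHomeomorph (M × G') Q)
    {U : Set M} (hU : IsOpen U) (hs : e.source = U ×ˢ Set.univ)
    (ht : e.target = u ⁻¹' (U ×ˢ Set.univ)) (hu : Continuous u) {σ : M → G}
    (hσ : ContinuousOn σ U) (hue : ∀ m ∈ U, ∀ g, u (e (m, g)) = (m, σ m * ρ g))
    {m : M} (hm : m ∈ U) {h : G} {I : Type*} [TopologicalSpace I]
    (hρ : IsEvenlyCovered ρ ((σ m)⁻¹ * h) I) : IsEvenlyCovered u (m, h) I := by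
  obtain ⟨hI, V, hxV, hV, hρV, H, hH⟩ := hρ
  have hδ : ContinuousOn (fun x : M × G => (σ x.1)⁻¹ * x.2) (U ×ˢ Set.univ) :=
    ((hσ.comp continuousOn_fst fun x hx => hx.1).inv).mul continuousOn_snd
  let W : Set (M × G) := (U ×ˢ Set.univ) ∩ (fun x : M × G => (σ x.1)⁻¹ * x.2) ⁻¹' V
  have hW : IsOpen W := hδ.isOpen_inter_preimage (hU.prod isOpen_univ) hV
  have hWU : ∀ x : W, x.1.1 ∈ U := fun x => x.2.1.1
  have hWV : ∀ x : W, (σ x.1.1)⁻¹ * x.1.2 ∈ V := fun x => x.2.2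
  have htgt : ∀ q : u ⁻¹' W, q.1 ∈ e.target := fun q => ht ▸ q.2.1
  have hfst : ∀ q : u ⁻¹' W, (e.symm q.1).1 ∈ U := fun q =>
    (hs ▸ e.map_target (htgt q) : e.symm q.1 ∈ U ×ˢ Set.univ).1
  have hform : ∀ q : u ⁻¹' W, u q.1 = ((e.symm q.1).1, σ (e.symm q.1).1 * ρ (e.symm q.1).2) :=
    fun q => by
      conv_lhs => rw [← e.right_inv (htgt q)]
      exact hue _ (hfst q) _
  have hρq : ∀ q : u ⁻¹' W, ρ (e.symm q.1).2 = (σ (u q.1).1)⁻¹ * (u q.1).2 := fun q => by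
    rw [hform q]; simp
  have hmemV : ∀ q : u ⁻¹' W, (e.symm q.1).2 ∈ ρ ⁻¹' V := fun q => by
    show ρ _ ∈ V
    rw [hρq q]; exact q.2.2
  -- The `G'`-coordinate of the point of sheet `i` lying over a given point of `W`.
  let b : W × I → G' := fun x => (H.symm (⟨_, hWV x.1⟩, x.2)).1
  have hb : ∀ x, ρ (b x) = (σ x.1.1.1)⁻¹ * x.1.1.2 := fun x => by
    rw [← hH, Homeomorph.apply_symm_apply]
  have hbsrc : ∀ x : W × I, (x.1.1.1, b x) ∈ e.source := fun x => by
    rw [hs]; exact ⟨hWU x.1, trivial⟩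
  have hub : ∀ x : W × I, u (e (x.1.1.1, b x)) = x.1.1 := fun x => by
    rw [hue _ (hWU x.1), hb]; simp
  have hδW : Continuous fun x : W => (⟨_, hWV x⟩ : V) :=
    (hδ.comp_continuous continuous_subtype_val fun x => x.2.1).subtype_mk _
  refine ⟨hI, W, ⟨⟨hm, trivial⟩, hxV⟩, hW, hW.preimage hu,
    { toFun q := (⟨u q.1, q.2⟩, (H ⟨(e.symm q.1).2, hmemV q⟩).2)
      invFun x := ⟨e (x.1.1.1, b x), by
        show u _ ∈ W
        rw [hub]; exact x.1.2⟩
      left_inv q := by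
        apply Subtype.ext
        have hbq : b (⟨u q.1, q.2⟩, (H ⟨(e.symm q.1).2, hmemV q⟩).2) = (e.symm q.1).2 := by
          have : ((⟨_, hWV ⟨u q.1, q.2⟩⟩ : V), (H ⟨(e.symm q.1).2, hmemV q⟩).2) =
              H ⟨(e.symm q.1).2, hmemV q⟩ :=
            Prod.ext (Subtype.ext ((hρq q).symm.trans (hH ⟨_, hmemV q⟩).symm)) rfl
          show (H.symm _).1 = _
          rw [this, H.symm_apply_apply]
        show e ((u q.1).1, b _) = q.1
        rw [hbq, show (u q.1).1 = (e.symm q.1).1 by rw [hform q]]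
        exact e.right_inv (htgt q)
      right_inv x := by
        refine Prod.ext (Subtype.ext (hub x)) ?_
        have hbx : (e.symm (e (x.1.1.1, b x))).2 = (H.symm (⟨_, hWV x.1⟩, x.2)).1 :=
          congrArg Prod.snd (e.left_inv (hbsrc x))
        show (H ⟨(e.symm (e (x.1.1.1, b x))).2, _⟩).2 = x.2
        rw [show (⟨(e.symm (e (x.1.1.1, b x))).2, hbx ▸ Subtype.property _⟩ : ρ ⁻¹' V) =
          H.symm (⟨_, hWV x.1⟩, x.2) from Subtype.ext hbx, H.apply_symm_apply]
      continuous_toFun := by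
        have : Continuous fun q : u ⁻¹' W => (e.symm q.1) :=
          e.continuousOn_symm.comp_continuous continuous_subtype_val htgt
        exact ((hu.comp continuous_subtype_val).subtype_mk _).prodMk
          (continuous_snd.comp (H.continuous.comp ((continuous_snd.comp this).subtype_mk _)))
      continuous_invFun := by
        have hbc : Continuous b := continuous_subtype_val.comp (H.symm.continuous.comp
          ((hδW.comp continuous_fst).prodMk continuous_snd))
        exact (e.continuousOn.comp_continuous
          ((continuous_fst.comp (continuous_subtype_val.comp continuous_fst)).prodMk hbc)
          hbsrc).subtype_mk _ }, fun q => rfl⟩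

section SpinorMaps

variable {EM : Type*} [NormedAddCommGroup EM] [NormedSpace ℝ EM]
  {HM : Type*} [TopologicalSpace HM] {IM : ModelWithCorners ℝ EM HM}
  {EG : Type*} [NormedAddCommGroup EG] [NormedSpace ℝ EG]
  {HG : Type*} [TopologicalSpace HG] {IG : ModelWithCorners ℝ EG HG}
  {EG' : Type*} [NormedAddCommGroup EG'] [NormedSpace ℝ EG']
  {HG' : Type*} [TopologicalSpace HG'] {IG' : ModelWithCorners ℝ EG' HG'}
  {ER : Type*} [NormedAddCommGroup ER] [NormedSpace ℝ ER]
  {HR : Type*} [TopologicalSpace HR] {IR : ModelWithCorners ℝ ER HR}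
  {M : Type*} [TopologicalSpace M] [ChartedSpace HM M]
  {G : Type*} [Group G] [TopologicalSpace G] [ChartedSpace HG G] [LieGroup IG ∞ G]
  {G' : Type*} [Group G'] [TopologicalSpace G'] [ChartedSpace HG' G']
  {R : Type*} [TopologicalSpace R] [ChartedSpace HR R]

theorem IsSpinorMap.apply_equivariant {ρ : G' →* G} {B : PrincipalBundle IM IG' IR M G' R}
    {v : R → M × G} (hv : IsSpinorMap ρ B (PrincipalBundle.trivial IM IG M G) v) (q : R) (g : G') :
    v (B.act q g) = (B.proj q, (v q).2 * ρ g) := by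
  rw [hv.map_act, ← hv.proj_map]
  rfl

theorem IsSpinorMap.isCoveringMap {ρ : G' →* G} (hρ : IsCoveringMap ρ)
    {B : PrincipalBundle IM IG' IR M G' R} {v : R → M × G}
    (hv : IsSpinorMap ρ B (PrincipalBundle.trivial IM IG M G) v) : IsCoveringMap v := by
  have : IsTopologicalGroup G := topologicalGroup_of_lieGroup IG ∞
  rintro ⟨m, h⟩
  obtain ⟨U, e, hU, hm, hs, ht, hproj, hact⟩ := B.local_triv m
  -- By equivariance `v` is determined on the chart by its `G`-component `σ` along the unit section.
  refine (isEvenlyCovered_of_trivialization_mul (σ := fun m => (v (e (m, 1))).2)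
    e.toOpenPartialHomeomorph hU hs ?_ hv.contMDiff.continuous ?_ ?_ hm
    (hρ _)).to_isEvenlyCovered_preimage
  · refine ht.trans (Set.ext fun q => ?_)
    rw [Set.mem_preimage, ← hv.proj_map]
    exact (and_iff_left trivial).symm
  · refine continuous_snd.comp_continuousOn (hv.contMDiff.continuous.comp_continuousOn
      (e.contMDiffOn.continuousOn.comp (continuousOn_id.prodMk continuousOn_const) fun m hm => ?_))
    rw [hs]
    exact ⟨hm, trivial⟩
  · intro m hm g
    show v (e (m, g)) = _
    rw [hact m hm g, hv.apply_equivariant, hproj m hm]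

/-- In a local trivialisation `s` has a continuous `G'`-coordinate `γ` with `ρ ∘ γ` smooth.
Continuity keeps `γ` near `m₁` inside the source of one local inverse of `ρ`, so `γ` is smooth
there. -/
theorem IsSpinorMap.contMDiff_lift {ρ : G' →* G} (hρ : IsLocalDiffeomorph IG' IG ∞ ρ)
    {B : PrincipalBundle IM IG' IR M G' R} {v : R → M × G}
    (hv : IsSpinorMap ρ B (PrincipalBundle.trivial IM IG M G) v) {s : M → R} (hs : Continuous s)
    {ζ : M → G} (hζ : ContMDiff IM IG ∞ ζ) (hvs : ∀ m, v (s m) = (m, ζ m)) :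
    ContMDiff IM IR ∞ s := by
  intro m₁
  obtain ⟨U, e, hU, hm₁, hsrc, htgt, hproj, hact⟩ := B.local_triv m₁
  have hps : ∀ m, B.proj (s m) = m := fun m => by
    rw [← hv.proj_map, hvs]; rfl
  have hst : ∀ m ∈ U, s m ∈ e.target := fun m hm => by
    rw [htgt, Set.mem_preimage, hps]; exact hm
  let γ : M → G' := fun m => (e.symm (s m)).2
  have hes : ∀ m ∈ U, e (m, γ m) = s m := fun m hm => by
    have h1 : e (e.symm (s m)) = s m := e.toOpenPartialHomeomorph.right_inv (hst m hm)
    have h2 : e.symm (s m) ∈ U ×ˢ Set.univ :=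
      hsrc ▸ e.toOpenPartialHomeomorph.map_target (hst m hm)
    have h3 : (e.symm (s m)).1 = m := by
      rw [← hproj _ h2.1 (e.symm (s m)).2, Prod.mk.eta, h1, hps]
    conv_rhs => rw [← h1, ← Prod.mk.eta (p := e.symm (s m)), h3]
  have hργ : ∀ m ∈ U, ρ (γ m) = ((v (e (m, 1))).2)⁻¹ * ζ m := fun m hm => by
    have := hvs m
    rw [← hes m hm, hact m hm, hv.apply_equivariant] at this
    rw [eq_inv_mul_iff_mul_eq]
    exact congrArg Prod.snd this
  have hUm : U ∈ nhds m₁ := hU.mem_nhds hm₁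
  have hγc : ContinuousAt γ m₁ :=
    continuous_snd.continuousAt.comp
      (ContinuousAt.comp (e.toOpenPartialHomeomorph.continuousAt_symm (hst m₁ hm₁)) hs.continuousAt)
  -- Stated for every `γ`: the constant `1` is needed first, to show that `ρ ∘ γ` is smooth.
  have hsec : ∀ γ : M → G', ContMDiffAt IM IG' ∞ γ m₁ →
      ContMDiffAt IM IR ∞ (fun m => e (m, γ m)) m₁ := fun γ hγ => by
    refine ContMDiffAt.comp (I' := IM.prod IG') m₁ (e.contMDiffOn.contMDiffAt
      (e.open_source.mem_nhds ?_)) (contMDiffAt_id.prodMk hγ)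
    rw [hsrc]; exact ⟨hm₁, trivial⟩
  obtain ⟨Φ, hΦ, hΦρ⟩ := hρ (γ m₁)
  have hγΦ : ∀ᶠ m in nhds m₁, γ m = Φ.symm (((v (e (m, 1))).2)⁻¹ * ζ m) := by
    filter_upwards [hUm, hγc (Φ.open_source.mem_nhds hΦ)] with m hm hmΦ
    rw [← hργ m hm, hΦρ hmΦ]
    exact (Φ.toOpenPartialHomeomorph.left_inv hmΦ).symm
  have hγ : ContMDiffAt IM IG' ∞ γ m₁ := by
    refine ContMDiffAt.congr_of_eventuallyEq ?_ hγΦ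
    refine ContMDiffAt.comp (I' := IG) m₁ (Φ.symm.contMDiffOn.contMDiffAt
      (Φ.open_target.mem_nhds ?_)) (ContMDiffAt.mul (ContMDiffAt.inv ?_) hζ.contMDiffAt)
    · rw [← hργ m₁ hm₁, hΦρ hΦ]
      exact Φ.map_source hΦ
    · exact contMDiffAt_snd.comp m₁ (hv.contMDiff.contMDiffAt.comp m₁
        (hsec (fun _ => 1) contMDiffAt_const))
  refine (hsec γ hγ).congr_of_eventuallyEq ?_
  filter_upwards [hUm] with m hm using (hes m hm).symm

/-- A smooth section trivialises a principal bundle. -/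
theorem PrincipalBundle.exists_isEquivalence_of_section [LieGroup IG' ∞ G']
    (B : PrincipalBundle IM IG' IR M G' R) {s : M → R} (hs : ContMDiff IM IR ∞ s)
    (hps : ∀ m, B.proj (s m) = m) :
    ∃ a : (M × G') ≃ₘ^∞⟮IM.prod IG', IR⟯ R,
      (PrincipalBundle.trivial IM IG' M G').IsEquivalence B a ∧
        ∀ x, a x = B.act (s x.1) x.2 := by
  -- The inverse trivialisation is `q ↦ (proj q, d q)`, where `d q` is the element carrying `s (proj
  -- q)` to `q`.
  choose d hd using fun q => B.transitive (s (B.proj q)) q (hps _)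
  have hact_inj : ∀ q g h, B.act q g = B.act q h → g = h := fun q g h hgh => by
    have := B.free q (g * h⁻¹) (by rw [B.act_mul, hgh, ← B.act_mul, mul_inv_cancel, B.act_one])
    exact mul_inv_eq_one.1 this
  refine ⟨⟨⟨fun x => B.act (s x.1) x.2, fun q => (B.proj q, d q), fun x => ?_, hd⟩, ?_, ?_⟩,
    ⟨fun x => ?_, fun x g => ?_⟩, fun x => rfl⟩
  · have hp : B.proj (B.act (s x.1) x.2) = x.1 := by rw [B.proj_act, hps]
    refine Prod.ext hp (hact_inj (s x.1) _ _ ?_)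
    have := hd (B.act (s x.1) x.2)
    rwa [hp] at this
  · exact B.contMDiff_act.comp ((hs.comp contMDiff_fst).prodMk contMDiff_snd)
  · intro q₁
    refine B.contMDiff_proj.contMDiffAt.prodMk ?_
    obtain ⟨U, e, hU, hm, hsrc, htgt, hproj, hact⟩ := B.local_triv (B.proj q₁)
    have hst : ∀ m ∈ U, s m ∈ e.target := fun m hm => by
      rw [htgt, Set.mem_preimage, hps]; exact hm
    have hsplit : ∀ q, B.proj q ∈ U → q = B.act (e (B.proj q, 1)) (e.symm q).2 := fun q hq => by
      have ht : q ∈ e.target := htgt ▸ hq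
      have h1 : e (e.symm q) = q := e.toOpenPartialHomeomorph.right_inv ht
      have h2 : e.symm q ∈ U ×ˢ Set.univ := hsrc ▸ e.toOpenPartialHomeomorph.map_target ht
      have h3 : (e.symm q).1 = B.proj q := by
        rw [← hproj _ h2.1 (e.symm q).2, Prod.mk.eta, h1]
      rw [← hact _ hq, ← h3, Prod.mk.eta, h1]
    -- In a chart `d` is a quotient of two `G'`-coordinates, which makes its smoothness visible.
    have hdq : ∀ q, B.proj q ∈ U → d q = ((e.symm (s (B.proj q))).2)⁻¹ * (e.symm q).2 :=
      fun q hq => by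
        have h := hd q
        have h' := hsplit (s (B.proj q)) (by rwa [hps])
        rw [hps] at h'
        rw [h', ← B.act_mul] at h
        conv_rhs at h => rw [hsplit q hq]
        rw [← hact_inj _ _ _ h, inv_mul_cancel_left]
    have hsymm : ∀ q, B.proj q ∈ U → ContMDiffAt IR IG' ∞ (fun q => (e.symm q).2) q :=
      fun q hq => contMDiffAt_snd.comp q (e.symm.contMDiffOn.contMDiffAt
        (e.open_target.mem_nhds (htgt ▸ hq)))
    refine ContMDiffAt.congr_of_eventuallyEq (f := fun q =>
      ((e.symm (s (B.proj q))).2)⁻¹ * (e.symm q).2) (ContMDiffAt.mul (ContMDiffAt.inv ?_)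
        (hsymm q₁ hm)) ?_
    · exact ContMDiffAt.comp (g := fun q => (e.symm q).2) (f := fun q => s (B.proj q)) q₁
        (hsymm (s (B.proj q₁)) (by rwa [hps]))
        (hs.contMDiffAt.comp q₁ B.contMDiff_proj.contMDiffAt)
    · filter_upwards [B.contMDiff_proj.continuous.continuousAt (hU.mem_nhds hm)] with q hq
      exact hdq q hq
  · show B.proj (B.act (s x.1) x.2) = x.1
    rw [B.proj_act, hps]
  · exact B.act_mul _ _ _

end SpinorMaps

/-! ### The lifting criterion with base points up to propositional equality -/

theorem IsCoveringMap.exists_lift_of_mapOfEq_range_le {A E X : Type*} [TopologicalSpace A]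
    [TopologicalSpace E] [TopologicalSpace X] [PathConnectedSpace A] [LocallyPathConnectedSpace A]
    {p : C(E, X)} (cov : IsCoveringMap p) {f : C(A, X)} {a₀ : A} {e₀ : E} {x₀ : X}
    (hp : p e₀ = x₀) (hf : f a₀ = x₀)
    (le : (FundamentalGroup.mapOfEq f hf).range ≤ (FundamentalGroup.mapOfEq p hp).range) :
    ∃ F : C(A, E), F a₀ = e₀ ∧ ∀ a, p (F a) = f a := by
  subst hf
  obtain ⟨F, ⟨hF, hpF⟩, -⟩ := cov.existsUnique_continuousMap_lifts_of_range_le hp (by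
    convert! le using 2
    ext a
    obtain ⟨γ, rfl⟩ := Path.Homotopic.Quotient.mk_surjective a
    exact (FundamentalGroup.mapOfEq_mk f rfl γ).symm)
  exact ⟨F, hF, congrFun hpF⟩

/-! ### Graphs of homomorphisms and sections of spinor structures -/

section Correspondence

variable {EM : Type*} [NormedAddCommGroup EM] [NormedSpace ℝ EM]
  {HM : Type*} [TopologicalSpace HM] {IM : ModelWithCorners ℝ EM HM}
  {EG : Type*} [NormedAddCommGroup EG] [NormedSpace ℝ EG]
  {HG : Type*} [TopologicalSpace HG] {IG : ModelWithCorners ℝ EG HG}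
  {EG' : Type*} [NormedAddCommGroup EG'] [NormedSpace ℝ EG']
  {HG' : Type*} [TopologicalSpace HG'] {IG' : ModelWithCorners ℝ EG' HG'}
  {ER : Type*} [NormedAddCommGroup ER] [NormedSpace ℝ ER]
  {HR : Type*} [TopologicalSpace HR] {IR : ModelWithCorners ℝ ER HR}
  {M : Type*} [TopologicalSpace M] [ChartedSpace HM M]
  {G : Type*} [Group G] [TopologicalSpace G] [ChartedSpace HG G] [LieGroup IG ∞ G]
  {G' : Type*} [Group G'] [TopologicalSpace G'] [ChartedSpace HG' G']
  {R : Type*} [TopologicalSpace R] [ChartedSpace HR R]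

/-- Left multiplication by `ζ` commutes with the right action. The case `ζ = 1` is the reference
structure. -/
theorem isSpinorMap_trivial_mul [LieGroup IG' ∞ G'] {ρ : G' →* G} (hρ : ContMDiff IG' IG ∞ ρ) {ζ : M → G}
    (hζ : ContMDiff IM IG ∞ ζ) :
    IsSpinorMap ρ (PrincipalBundle.trivial IM IG' M G') (PrincipalBundle.trivial IM IG M G)
      (fun x : M × G' => ((x.1, ζ x.1 * ρ x.2) : M × G)) where
  contMDiff := contMDiff_fst.prodMk
    ((hζ.comp contMDiff_fst).mul (hρ.comp contMDiff_snd))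
  proj_map _ := rfl
  map_act q g := by
    show (_, _) = (_, _)
    simp [PrincipalBundle.trivial, mul_assoc]

/-- The image of the product spinor structure on `π₁` is the subgroup `π₁(M) × 1` of
`π₁(M × G) = π₁(M) × π₁(G)`. -/
theorem mem_imagePi_trivial_iff {ρ : G' →* G} [LieGroup IG' ∞ G']
    [SimplyConnectedSpace G'] {m₀ : M}
    (hu : IsSpinorMap ρ (PrincipalBundle.trivial IM IG' M G') (PrincipalBundle.trivial IM IG M G)
      (fun x : M × G' => ((x.1, ρ x.2) : M × G)))
    {q₀ : M × G'} (hq : hu.toMap q₀ = (m₀, 1)) (k : FundamentalGroup (M × G) (m₀, 1)) :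
    k ∈ hu.imagePi hq ↔ FundamentalGroup.snd m₀ 1 k = 1 := by
  obtain ⟨m, g⟩ := q₀
  obtain rfl : m = m₀ := congrArg Prod.fst hq
  have hg : ρ g = 1 := congrArg Prod.snd hq
  let r : C(G', G) := ⟨ρ, continuous_snd.comp
    (hu.contMDiff.continuous.comp (Continuous.prodMk_right m))⟩
  constructor
  · rintro ⟨y, rfl⟩
    refine (FundamentalGroup.snd_mapOfEq hq (g := r.comp ContinuousMap.snd) hg
      (fun _ => rfl) y).trans ((FundamentalGroup.mapOfEq_comp r ContinuousMap.snd rfl hg hg y).trans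
        ?_)
    -- The second component factors through `π₁(G')`, which is trivial.
    rw [Subsingleton.elim (FundamentalGroup.mapOfEq ContinuousMap.snd _ y) 1, map_one]
  · intro hk
    -- The slice at height `g` lies over `M × {1}` because `ρ g = 1`.
    let j : C(M, M × G') := (ContinuousMap.id M).prodMk (ContinuousMap.const M g)
    have hj : j m = (m, g) := rfl
    refine ⟨FundamentalGroup.mapOfEq j hj (FundamentalGroup.fst m 1 k), ?_⟩
    rw [← FundamentalGroup.mapOfEq_comp hu.toMap j hj hq hq]
    apply FundamentalGroup.prod_ext
    · rw [FundamentalGroup.fst_mapOfEq (f := hu.toMap.comp j) hq (g := ContinuousMap.id M) rfl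
        fun _ => rfl]
      exact FundamentalGroup.mapOfEq_eq_self (fun _ => rfl) _
    · rw [hk, FundamentalGroup.snd_mapOfEq (f := hu.toMap.comp j) hq
        (g := ContinuousMap.const M 1) rfl fun _ => hg]
      exact FundamentalGroup.mapOfEq_eq_one (fun _ => rfl) _

/-- If a spinor structure corresponds to `φ`, then its image on `π₁` is the graph of `φ` in
`π₁(M × G) = π₁(M) × π₁(G)`. -/
theorem CorrespondsTo.exists_mem_imagePi_iff {ρ : G' →* G} [LieGroup IG' ∞ G']
    [SimplyConnectedSpace G'] {m₀ : M}
    {hu : IsSpinorMap ρ (PrincipalBundle.trivial IM IG' M G') (PrincipalBundle.trivial IM IG M G)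
      (fun x : M × G' => ((x.1, ρ x.2) : M × G))}
    {B : PrincipalBundle IM IG' IR M G' R} {v : R → M × G}
    {hv : IsSpinorMap ρ B (PrincipalBundle.trivial IM IG M G) v}
    {φ : FundamentalGroup M m₀ →* FundamentalGroup G 1}
    (h : CorrespondsTo hu hv (p₀ := ((m₀, 1) : M × G)) (m₀ := m₀) rfl φ) :
    ∃ (r₀ : R) (hr : hv.toMap r₀ = (m₀, 1)), ∀ x : FundamentalGroup (M × G) (m₀, 1),
      x ∈ hv.imagePi hr ↔ FundamentalGroup.snd m₀ 1 x = φ (FundamentalGroup.fst m₀ 1 x) := by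
  obtain ⟨q₀, hq, r₀, hr, h⟩ := h
  let i : FundamentalGroup G 1 →* FundamentalGroup (M × G) (m₀, 1) :=
    FundamentalGroup.mapOfEq ((PrincipalBundle.trivial IM IG M G).orbitMap (m₀, 1))
      ((PrincipalBundle.trivial IM IG M G).orbitMap_one (m₀, 1))
  have hfst : ∀ a, FundamentalGroup.fst m₀ 1 (i a) = 1 := fun a =>
    (FundamentalGroup.fst_mapOfEq _ (g := ContinuousMap.const G m₀) rfl (fun _ => rfl) a).trans
      (FundamentalGroup.mapOfEq_eq_one (fun _ => rfl) a)
  have hsnd : ∀ a, FundamentalGroup.snd m₀ 1 (i a) = a := fun a =>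
    (FundamentalGroup.snd_mapOfEq _ (g := ContinuousMap.id G) rfl (fun g => one_mul g) a).trans
      (FundamentalGroup.mapOfEq_eq_self (fun _ => rfl) a)
  replace h : ∀ x, x ∈ hv.imagePi hr ↔
      ∃ k ∈ hu.imagePi hq, x = k * i (φ (FundamentalGroup.fst m₀ 1 k)) := h
  refine ⟨r₀, hr, fun x => (h x).trans ⟨?_, fun hx => ?_⟩⟩
  · rintro ⟨k, hk, rfl⟩
    rw [mem_imagePi_trivial_iff] at hk
    rw [map_mul, map_mul, hfst, hsnd, hk, one_mul, mul_one]
  -- Dividing by `i_*` of `φ (fst x)` kills the second component and leaves the first unchanged.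
  · refine ⟨x * (i (φ (FundamentalGroup.fst m₀ 1 x)))⁻¹, ?_, ?_⟩
    · rw [mem_imagePi_trivial_iff, map_mul, map_inv, hsnd, hx, mul_inv_cancel]
    · rw [map_mul, map_inv, hfst, inv_one, mul_one, inv_mul_cancel_right]

/-- The first `π₁` projection of the graph map `m ↦ (m, ζ m)` is the identity, the second
is `ζ_*`. -/
theorem FundamentalGroup.fst_snd_graph {f : C(M, M × G)} (hf₁ : ∀ m, (f m).1 = m) {m₀ : M}
    (hf : f m₀ = (m₀, 1)) {ζ : C(M, G)} (hζ : ζ m₀ = 1) (hf₂ : ∀ m, (f m).2 = ζ m)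
    (a : FundamentalGroup M m₀) :
    FundamentalGroup.fst m₀ 1 (FundamentalGroup.mapOfEq f hf a) = a ∧
      FundamentalGroup.snd m₀ 1 (FundamentalGroup.mapOfEq f hf a) =
        FundamentalGroup.mapOfEq ζ hζ a :=
  ⟨(fst_mapOfEq hf (g := ContinuousMap.id M) rfl hf₁ a).trans (mapOfEq_eq_self (fun _ => rfl) a),
    snd_mapOfEq hf hζ hf₂ a⟩

/-- A map `ζ` realising `φ` lifts to a section of a spinor structure corresponding to `φ`. -/
theorem exists_section_of_realises {ρ : G' →* G} (hρ : IsCoveringMap ρ)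
    (hρ' : IsLocalDiffeomorph IG' IG ∞ ρ) [PathConnectedSpace M]
    [LocallyPathConnectedSpace M] [PathConnectedSpace G] {m₀ : M}
    {B : PrincipalBundle IM IG' IR M G' R} {v : R → M × G}
    (hv : IsSpinorMap ρ B (PrincipalBundle.trivial IM IG M G) v)
    {φ : FundamentalGroup M m₀ →* FundamentalGroup G 1} {r₀ : R} (hr : hv.toMap r₀ = (m₀, 1))
    (h : ∀ x : FundamentalGroup (M × G) (m₀, 1),
      x ∈ hv.imagePi hr ↔ FundamentalGroup.snd m₀ 1 x = φ (FundamentalGroup.fst m₀ 1 x))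
    {ζ : C^∞⟮IM, M; IG, G⟯} (hζ : Realises ζ φ) :
    ∃ s : M → R, ContMDiff IM IR ∞ s ∧ ∀ m, v (s m) = (m, ζ m) := by
  have : IsTopologicalGroup G := topologicalGroup_of_lieGroup IG ∞
  have cov : IsCoveringMap hv.toMap := hv.isCoveringMap hρ
  -- Normalised to send `m₀` to `(m₀, 1)`, where the criterion applies.
  let f : C(M, M × G) := (ContinuousMap.id M).prodMk (translateToOne ζ m₀)
  have hf : f m₀ = (m₀, 1) := Prod.ext rfl (translateToOne_self ζ m₀)
  obtain ⟨F, -, hF⟩ := cov.exists_lift_of_mapOfEq_range_le hr hf (by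
    rintro _ ⟨a, rfl⟩
    refine (h _).2 ?_
    obtain ⟨h₁, h₂⟩ := FundamentalGroup.fst_snd_graph (fun _ => rfl) hf (translateToOne_self ζ m₀)
      (fun _ => rfl) a
    rw [h₁, h₂, show FundamentalGroup.mapOfEq _ _ = φ from hζ])
  -- Left multiplication along `c` deforms the graph of `ζ(m₀)⁻¹ ζ` to that of `ζ`; the lift is
  -- taken at time `1`.
  let c : Path (1 : G) (ζ m₀) := PathConnectedSpace.somePath 1 (ζ m₀)
  let H : C(unitInterval × M, M × G) := ⟨fun x => (x.2, c x.1 * ((ζ m₀)⁻¹ * ζ x.2)),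
    continuous_snd.prodMk ((c.continuous.comp continuous_fst).mul
      (continuous_const.mul (ζ.contMDiff.continuous.comp continuous_snd)))⟩
  have hH : ∀ m, H (0, m) = hv.toMap (F m) := fun m => by
    rw [hF]
    show (m, c 0 * ((ζ m₀)⁻¹ * ζ m)) = (m, (ζ m₀)⁻¹ * ζ m)
    rw [c.source, one_mul]
  have hs : ∀ m, v (cov.liftHomotopy H F hH (1, m)) = (m, ζ m) := fun m => by
    refine (congrFun (cov.liftHomotopy_lifts H F hH) (1, m)).trans ?_
    show (m, c 1 * ((ζ m₀)⁻¹ * ζ m)) = (m, ζ m)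
    rw [c.target, mul_inv_cancel_left]
  exact ⟨_, hv.contMDiff_lift hρ' ((cov.liftHomotopy H F hH).continuous.comp
    (Continuous.prodMk_right 1)) ζ.contMDiff hs, hs⟩

theorem exists_realises_of_isTrivial [LieGroup IG' ∞ G'] {ρ : G' →* G} {m₀ : M}
    {B : PrincipalBundle IM IG' IR M G' R} {v : R → M × G}
    (hv : IsSpinorMap ρ B (PrincipalBundle.trivial IM IG M G) v)
    {φ : FundamentalGroup M m₀ →* FundamentalGroup G 1} {r₀ : R} (hr : hv.toMap r₀ = (m₀, 1))
    (h : ∀ x : FundamentalGroup (M × G) (m₀, 1),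
      x ∈ hv.imagePi hr ↔ FundamentalGroup.snd m₀ 1 x = φ (FundamentalGroup.fst m₀ 1 x))
    (hB : B.IsTrivial) : ∃ ζ : C^∞⟮IM, M; IG, G⟯, Realises ζ φ := by
  obtain ⟨a, ha, -⟩ := hB
  have hpr : B.proj r₀ = m₀ := (hv.proj_map r₀).symm.trans (congrArg Prod.fst hr)
  -- Translating the unit section by `g` makes it pass through `r₀`, the base point used in `h`.
  obtain ⟨g, hg⟩ := B.transitive (a (m₀, 1)) r₀ ((ha _).trans hpr.symm)
  have hs : ContMDiff IM IR ∞ fun m => B.act (a (m, 1)) g :=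
    B.contMDiff_act.comp
      ((a.contMDiff.comp (contMDiff_id.prodMk contMDiff_const)).prodMk contMDiff_const)
  let s : C(M, R) := ⟨fun m => B.act (a (m, 1)) g, hs.continuous⟩
  have hps : ∀ m, B.proj (s m) = m := fun m => (B.proj_act _ _).trans (ha _)
  have hs₀ : s m₀ = r₀ := hg
  have hvs : hv.toMap.comp s m₀ = (m₀, 1) := (congrArg v hs₀).trans hr
  let ζ : C^∞⟮IM, M; IG, G⟯ := ⟨fun m => (v (s m)).2, contMDiff_snd.comp (hv.contMDiff.comp hs)⟩
  have hζ : ζ m₀ = 1 := congrArg Prod.snd hvs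
  refine ⟨ζ, MonoidHom.ext fun α => ?_⟩
  obtain ⟨h₁, h₂⟩ := FundamentalGroup.fst_snd_graph (f := hv.toMap.comp s)
    (fun m => (hv.proj_map _).trans (hps m)) hvs (translateToOne_self ζ m₀) (fun m => by
      show ζ m = (ζ m₀)⁻¹ * ζ m
      rw [hζ, inv_one, one_mul]) α
  -- The class of the graph lies in `v_*(π₁(R))`, being `v_*` of `s_* α`.
  rw [← h₂, (h _).1, h₁]
  exact ⟨FundamentalGroup.mapOfEq s hs₀ α,
    (FundamentalGroup.mapOfEq_comp hv.toMap s hs₀ hr hvs α).symm⟩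

end Correspondence

/-! ### The main theorem -/

theorem mainTheorem8
    {EM : Type*} [NormedAddCommGroup EM] [NormedSpace ℝ EM] [FiniteDimensional ℝ EM]
    {EG : Type*} [NormedAddCommGroup EG] [NormedSpace ℝ EG] [FiniteDimensional ℝ EG]
    {EG' : Type*} [NormedAddCommGroup EG'] [NormedSpace ℝ EG'] [FiniteDimensional ℝ EG']
    {M : Type*} [TopologicalSpace M] [ChartedSpace EM M] [IsManifold 𝓘(ℝ, EM) ∞ M]
    [T2Space M] [ParacompactSpace M] [ConnectedSpace M]
    {G : Type*} [Group G] [TopologicalSpace G] [ChartedSpace EG G]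
    [LieGroup 𝓘(ℝ, EG) ∞ G] [T2Space G] [ConnectedSpace G]
    {G' : Type*} [Group G'] [TopologicalSpace G'] [ChartedSpace EG' G']
    [LieGroup 𝓘(ℝ, EG') ∞ G'] [T2Space G']
    (ρ : G' →* G) (hρ : IsUniversalCoveringGroup 𝓘(ℝ, EG') 𝓘(ℝ, EG) ρ)
    (m₀ : M) :
    ∃ hu : IsSpinorMap ρ (PrincipalBundle.trivial 𝓘(ℝ, EM) 𝓘(ℝ, EG') M G')
        (PrincipalBundle.trivial 𝓘(ℝ, EM) 𝓘(ℝ, EG) M G)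
        (fun x : M × G' => ((x.1, ρ x.2) : M × G)),
      ∀ (φ : FundamentalGroup M m₀ →* FundamentalGroup G 1)
        {EQ : Type*} [NormedAddCommGroup EQ] [NormedSpace ℝ EQ]
        {HQ : Type*} [TopologicalSpace HQ] {IQ : ModelWithCorners ℝ EQ HQ}
        {Q' : Type*} [TopologicalSpace Q'] [ChartedSpace HQ Q'] [IsManifold IQ ∞ Q']
        (B' : PrincipalBundle 𝓘(ℝ, EM) 𝓘(ℝ, EG') IQ M G' Q') (u' : Q' → M × G)
        (hu' : IsSpinorMap ρ B' (PrincipalBundle.trivial 𝓘(ℝ, EM) 𝓘(ℝ, EG) M G) u'),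
        CorrespondsTo hu hu' (p₀ := ((m₀, 1) : M × G)) (m₀ := m₀) rfl φ →
          ((∃ ζ : C^∞⟮𝓘(ℝ, EM), M; 𝓘(ℝ, EG), G⟯, Realises ζ φ) ↔ B'.IsTrivial) ∧
          ∀ ζ : C^∞⟮𝓘(ℝ, EM), M; 𝓘(ℝ, EG), G⟯, Realises ζ φ →
            IsSpinorMap ρ (PrincipalBundle.trivial 𝓘(ℝ, EM) 𝓘(ℝ, EG') M G')
              (PrincipalBundle.trivial 𝓘(ℝ, EM) 𝓘(ℝ, EG) M G)
              (fun x : M × G' => ((x.1, ζ x.1 * ρ x.2) : M × G)) ∧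
            SpinorEquivalent (PrincipalBundle.trivial 𝓘(ℝ, EM) 𝓘(ℝ, EG') M G') B'
              (fun x : M × G' => ((x.1, ζ x.1 * ρ x.2) : M × G)) u' := by
  have := hρ.simplyConnected
  have : LocallyPathConnectedSpace M := ChartedSpace.locallyPathConnectedSpace EM M
  have : LocallyPathConnectedSpace G := ChartedSpace.locallyPathConnectedSpace EG G
  have : PathConnectedSpace M := pathConnectedSpace_iff_connectedSpace.2 inferInstance
  have : PathConnectedSpace G := pathConnectedSpace_iff_connectedSpace.2 inferInstance
  have hρs : ContMDiff 𝓘(ℝ, EG') 𝓘(ℝ, EG) ∞ ρ := hρ.isLocalDiffeomorph.contMDiff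
  refine ⟨by simpa only [one_mul] using
    isSpinorMap_trivial_mul (IM := 𝓘(ℝ, EM)) (M := M) hρs (contMDiff_const (c := (1 : G))), ?_⟩
  intro φ EQ _ _ HQ _ IQ Q' _ _ _ B' u' hu' hφ
  obtain ⟨r₀, hr, h⟩ := hφ.exists_mem_imagePi_iff
  -- This gives the equivalence in part 2 and, forgetting the spinor maps, the triviality in part 1.
  have key : ∀ ζ : C^∞⟮𝓘(ℝ, EM), M; 𝓘(ℝ, EG), G⟯, Realises ζ φ →
      SpinorEquivalent (PrincipalBundle.trivial 𝓘(ℝ, EM) 𝓘(ℝ, EG') M G') B'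
        (fun x : M × G' => ((x.1, ζ x.1 * ρ x.2) : M × G)) u' := fun ζ hζ => by
    obtain ⟨s, hs, hus⟩ :=
      exists_section_of_realises hρ.isCoveringMap hρ.isLocalDiffeomorph hu' hr h hζ
    have hps : ∀ m, B'.proj (s m) = m := fun m => by
      rw [← hu'.proj_map, hus]
      rfl
    obtain ⟨a, ha, has⟩ := B'.exists_isEquivalence_of_section hs hps
    refine ⟨a, ha, fun x => ?_⟩
    rw [has, hu'.apply_equivariant, hps, hus]
  refine ⟨⟨fun ⟨ζ, hζ⟩ => ?_, exists_realises_of_isTrivial hu' hr h⟩,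
    fun ζ hζ => ⟨isSpinorMap_trivial_mul hρs ζ.contMDiff, key ζ hζ⟩⟩
  obtain ⟨a, ha, -⟩ := key ζ hζ
  exact ⟨a, ha⟩
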